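/- Let $n,m\in\mathbb N_0$, let $L\in\mathbb R^{m\times n}$ with transpose $L^*$ and null space $\mathcal N(L)$, and let $\|\cdot\|$ be an arbitrary norm on $\mathbb R^m$ with dual norm $\|p\|_*=\max_{\|y\|\le 1}\langle p,y\rangle$. Write $\Gamma_0(X)$ for the set of proper, convex, lower semicontinuous functions $X\to\mathbb R\cup\{+\infty\}$, $\operatorname{dom} f=\{x: f(x)<+\infty\}$, and $\Phi^*(p)=\sup_{x\in\mathbb R^n}\{\langle p,x\rangle-\Phi(x)\}$. Let $\Phi\in\Gamma_0(\mathbb R^n)$. Suppose that $\mathbb R^n=X_1\oplus X_2\oplus X_3$ with pairwise orthogonal subspaces $X_1,X_2,X_3$, and that, for all $x_i\in X_i$ $(i=1,2,3)$, $$\Phi(x_1+x_2+x_3)=\begin{cases}\phi(x_1)&\text{if }x_3=0,\\ +\infty&\text{if }x_3\neq 0,\end{cases}$$ where $\phi=\Phi|_{X_1}:X_1\to\mathbb R\cup\{+\infty\}$ satisfies: 1. $\operatorname{dom}\phi$ is open in $X_1$ and $0\in\overline{\operatorname{dom}\phi}$; 2. $\phi\in\Gamma_0(X_1)$, $\phi$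 is strictly convex (on $\operatorname{dom}\phi$), and $\phi$ is essentially smooth, i.e. $C=\operatorname{int}(\operatorname{dom}\phi)$ (interior in $X_1$) is nonempty, $\phi$ is differentiable on $C$, and $\|\nabla\phi(u_k)\|_2\to+\infty$ for every sequence $(u_k)$ in $C$ that converges to a boundary point of $C$; 3. $\phi$ has a minimizer. Assume $X_2\cap\mathcal N(L)=\{0\}$ and $\operatorname{argmin}\Phi\cap\mathcal N(L)=\emptyset$. Then for all $\tau,\lambda\in(0,+\infty)$ each of the problems $$(P_{1,\tau})\quad \text{minimize } \Phi(x)\ \text{ over } x\in\mathbb R^n\ \text{ with } \|Lx\|\le\tau,$$ $$(P_{2,\lambda})\quad \text{minimize } \Phi(x)+\lambda\|Lx\|\ \text{ over } x\in\mathbb R^n,$$ $$(D_{1,\tau})\quad \text{minimize } \Phi^*(-L^*p)+\tau\|p\|_*\ \text{ over } p\in\mathbb R^m,$$ $$(D_{2,\lambda})\quad \text{minimize } \Phi^*(-L^*p)\ \text{ over } p\in\mathbb R^m\ \text{ with } \|p\|_*\le\lambda$$ has a nonempty set of solutions, and its minimum is finite (a real number). -/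

import Mathlib

open Filter Topology

namespace Solvers

section General

variable {E : Type*} [NormedAddCommGroup E] [InnerProductSpace ℝ E]

/-- The effective domain of an extended-real-valued function. -/
def effDom (f : E → EReal) : Set E := {x | f x < ⊤}

/-- `f` is proper, convex and closed (lower semicontinuous), with values in `ℝ ∪ {+∞}`.
Convexity is convexity of the epigraph. -/
structure IsGammaZero (f : E → EReal) : Prop where
  ne_bot : ∀ x, f x ≠ ⊥
  dom_nonempty : (effDom f).Nonempty
  convex : Convex ℝ {q : E × ℝ | f q.1 ≤ (q.2 : EReal)}
  lsc : LowerSemicontinuous f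

/-- Strict convexity of a proper function: it is strictly convex, as a real-valued function,
on its effective domain. -/
def IsStrictlyConvex (f : E → EReal) : Prop :=
  StrictConvexOn ℝ (effDom f) (fun x => (f x).toReal)

/-- Essential smoothness of a proper convex function: the interior `C` of the
effective domain is nonempty, `f` is differentiable on `C`, and the norm of the derivative (which
is the Euclidean norm of the gradient) tends to `+∞` along every sequence in `C` that converges to
a boundary point of `C`. -/
structure IsEssentiallySmooth (f : E → EReal) : Prop where
  interior_nonempty : (interior (effDom f)).Nonempty
  differentiable : ∀ x ∈ interior (effDom f), DifferentiableAt ℝ (fun y => (f y).toReal) x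
  steep : ∀ x ∈ frontier (interior (effDom f)), ∀ u : ℕ → E,
    (∀ k, u k ∈ interior (effDom f)) → Tendsto u atTop (𝓝 x) →
      Tendsto (fun k => ‖fderiv ℝ (fun y => (f y).toReal) (u k)‖) atTop atTop

/-- The Fenchel conjugate `f*(p) = sup_x (⟨p, x⟩ - f x)`. -/
noncomputable def conjugate (f : E → EReal) (p : E) : EReal :=
  ⨆ x : E, (((inner ℝ p x : ℝ) : EReal) - f x)

/-- The set of minimizers of `f` subject to the constraint `x ∈ S`. -/
def argminOn (f : E → EReal) (S : Set E) : Set E := {x | x ∈ S ∧ ∀ y ∈ S, f x ≤ f y}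

/-- The set of minimizers of `f` on the whole space. -/
def argmin (f : E → EReal) : Set E := argminOn f Set.univ

/-- The problem of minimizing `f` over `S` has a solution, and its minimum is a real number. -/
def HasSolutionWithFiniteMin (f : E → EReal) (S : Set E) : Prop :=
  (argminOn f S).Nonempty ∧ ∃ r : ℝ, IsLeast (f '' S) (r : EReal)

/-- The dual norm `‖p‖_* = max {⟨p, x⟩ : ‖x‖ ≤ 1}` of a norm `N`. -/
noncomputable def dualNorm (N : Seminorm ℝ E) (p : E) : ℝ :=
  sSup {r : ℝ | ∃ x : E, N x ≤ 1 ∧ r = inner ℝ p x}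

/-- The ambient space is the direct sum of the pairwise orthogonal subspaces `X₁`, `X₂`, `X₃`
(directness follows from orthogonality), and
`Φ (x₁ + x₂ + x₃)` is `φ x₁` if `x₃ = 0` and `+∞` otherwise, where the restriction `φ = Φ|_{X₁}`
has an effective domain that is open in `X₁` and whose closure contains `0`, is proper, convex and
closed, strictly convex and essentially smooth, and has a minimizer. -/
structure IsSetting (Φ : E → EReal) (X₁ X₂ X₃ : Submodule ℝ E) : Prop where
  span : X₁ ⊔ X₂ ⊔ X₃ = ⊤
  orth₁₂ : X₁ ⟂ X₂
  orth₁₃ : X₁ ⟂ X₃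
  orth₂₃ : X₂ ⟂ X₃
  eq_of_eq_zero : ∀ x₁ ∈ X₁, ∀ x₂ ∈ X₂, ∀ x₃ ∈ X₃, x₃ = 0 → Φ (x₁ + x₂ + x₃) = Φ x₁
  eq_of_ne_zero : ∀ x₁ ∈ X₁, ∀ x₂ ∈ X₂, ∀ x₃ ∈ X₃, x₃ ≠ 0 → Φ (x₁ + x₂ + x₃) = ⊤
  dom_open : IsOpen (effDom (fun x : X₁ => Φ x))
  zero_mem : (0 : X₁) ∈ closure (effDom (fun x : X₁ => Φ x))
  gammaZero : IsGammaZero (fun x : X₁ => Φ x)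
  strictlyConvex : IsStrictlyConvex (fun x : X₁ => Φ x)
  essentiallySmooth : IsEssentiallySmooth (fun x : X₁ => Φ x)
  exists_minimizer : (argmin (fun x : X₁ => Φ x)).Nonempty

end General

end Solvers

/-!
A closed convex function on a finite-dimensional space has bounded sublevel sets as soon as one
nonempty sublevel set is bounded. Let `z` minimize `Φ`, and suppose that the minimizers `x` of `Φ`
with `A x = A z` form a bounded set. They are the minimizers of `Φ + ‖A (· - z)‖`, so the sets
`{x | Φ x ≤ c ∧ ‖A x‖ ≤ t}` are bounded and both primal problems have solutions. For the penalized
dual, a point `x₀` of the domain with `‖A x₀‖ < τ` exists because `0` is in the closure of the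
domain, and `Φ* (-A* p) + τ ‖p‖_* ≥ (τ - ‖A x₀‖) ‖p‖_* - Φ x₀`; the feasible set of the constrained
dual is compact. Feasibility in both duals is clear at `p = 0`, since `Φ* 0 = -min Φ`.

In the decomposed setting, strict convexity makes the minimizer of `φ` unique, so any two
minimizers of `Φ` differ by an element of `X₂`; as `X₂` meets the kernel of `A` trivially, `z` is
the only minimizer in its fibre.
-/

namespace Solvers

section LowerSemicontinuity

variable {X : Type*} [TopologicalSpace X]

theorem lowerSemicontinuous_add_coe {f : X → EReal} {g : X → ℝ}
    (hf : LowerSemicontinuous f) (hg : LowerSemicontinuous g) :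
    LowerSemicontinuous fun x => f x + (g x : EReal) := by
  have hg' : LowerSemicontinuous fun x => (g x : EReal) :=
    continuous_coe_real_ereal.comp_lowerSemicontinuous hg EReal.coe_strictMono.monotone
  exact hf.add' hg' fun x =>
    EReal.continuousAt_add (Or.inr (EReal.coe_ne_bot _)) (Or.inr (EReal.coe_ne_top _))

theorem exists_coe_lt_forall_le_of_isCompact {f : X → EReal} {K : Set X} (hK : IsCompact K)
    (hf : LowerSemicontinuousOn f K) {μ : ℝ} (hμ : ∀ x ∈ K, (μ : EReal) < f x) :
    ∃ a : ℝ, μ < a ∧ ∀ x ∈ K, (a : EReal) ≤ f x := by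
  rcases K.eq_empty_or_nonempty with rfl | hne
  · exact ⟨μ + 1, lt_add_one μ, by simp⟩
  · obtain ⟨w, hw, hmin⟩ := hf.exists_isMinOn hne hK
    obtain ⟨a, hμa, haw⟩ := EReal.lt_iff_exists_real_btwn.1 (hμ w hw)
    exact ⟨a, EReal.coe_lt_coe_iff.1 hμa, fun x hx => haw.le.trans (hmin hx)⟩

end LowerSemicontinuity

theorem add_coe_le_coe_iff {a : EReal} {r s : ℝ} :
    a + (r : EReal) ≤ s ↔ a ≤ ((s - r : ℝ) : EReal) :=
  (EReal.le_sub_iff_add_le (Or.inr (EReal.coe_ne_bot s)) (Or.inr (EReal.coe_ne_top s))).symm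

theorem continuous_seminorm {V : Type*} [NormedAddCommGroup V] [NormedSpace ℝ V]
    [FiniteDimensional ℝ V] (p : Seminorm ℝ V) : Continuous p :=
  continuousOn_univ.1 (p.convexOn.continuousOn isOpen_univ)

section GammaZero

variable {E : Type*} [NormedAddCommGroup E] [InnerProductSpace ℝ E] {f : E → EReal}

theorem isGammaZero_zero : IsGammaZero fun _ : E => (0 : EReal) where
  ne_bot _ := EReal.zero_ne_bot
  dom_nonempty := ⟨0, EReal.zero_lt_top⟩
  convex := by
    simp only [EReal.coe_nonneg]
    exact (convex_Ici 0).linear_preimage (LinearMap.snd ℝ E ℝ)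
  lsc := lowerSemicontinuous_const

theorem IsGammaZero.le_segment (hf : IsGammaZero f) {x y : E} {a b s t : ℝ} (hx : f x ≤ a)
    (hy : f y ≤ b) (hs : 0 ≤ s) (ht : 0 ≤ t) (hst : s + t = 1) :
    f (s • x + t • y) ≤ ((s * a + t * b : ℝ) : EReal) :=
  hf.convex (x := (x, a)) hx (y := (y, b)) hy hs ht hst

theorem IsGammaZero.add_coe (hf : IsGammaZero f) {g : E → ℝ} (hg : ConvexOn ℝ Set.univ g)
    (hlsc : LowerSemicontinuous g) : IsGammaZero fun x => f x + (g x : EReal) where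
  ne_bot x := EReal.add_ne_bot_iff.2 ⟨hf.ne_bot x, EReal.coe_ne_bot (g x)⟩
  dom_nonempty := hf.dom_nonempty.imp fun _ hx => EReal.add_lt_top hx.ne (EReal.coe_ne_top _)
  convex := by
    rintro ⟨x, a⟩ hx ⟨y, b⟩ hy s t hs ht hst
    refine add_coe_le_coe_iff.2 ?_
    have hfst := hf.le_segment (add_coe_le_coe_iff.1 hx) (add_coe_le_coe_iff.1 hy) hs ht hst
    have hgst : g (s • x + t • y) ≤ s * g x + t * g y := hg.2 trivial trivial hs ht hst
    refine hfst.trans (EReal.coe_le_coe_iff.2 ?_)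
    simp only [Prod.snd_add, Prod.smul_snd, Prod.fst_add, Prod.smul_fst, smul_eq_mul]
    linarith
  lsc := lowerSemicontinuous_add_coe hf.lsc hlsc

theorem IsGammaZero.exists_eq_coe_and_forall_le (hf : IsGammaZero f) {z : E} (hz : z ∈ argmin f) :
    ∃ μ : ℝ, f z = μ ∧ ∀ x, (μ : EReal) ≤ f x := by
  obtain ⟨y, hy⟩ := hf.dom_nonempty
  have hz_top : f z < ⊤ := (hz.2 y trivial).trans_lt hy
  have hμ : ((f z).toReal : EReal) = f z := EReal.coe_toReal hz_top.ne (hf.ne_bot z)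
  exact ⟨(f z).toReal, hμ.symm, fun x => hμ.trans_le (hz.2 x trivial)⟩

theorem IsGammaZero.argmin_subsingleton (hf : IsGammaZero f) (hs : IsStrictlyConvex f) :
    (argmin f).Subsingleton := by
  have hdom : argmin f ⊆ effDom f := fun x hx => by
    obtain ⟨μ, hμ, -⟩ := hf.exists_eq_coe_and_forall_le hx
    exact hμ.trans_lt (EReal.coe_lt_top μ)
  have hmin : ∀ x ∈ argmin f, IsMinOn (fun x => (f x).toReal) (effDom f) x := fun x hx y hy =>
    EReal.toReal_le_toReal (hx.2 y trivial) (hf.ne_bot x) (ne_of_lt hy)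
  exact fun x hx y hy => StrictConvexOn.eq_of_isMinOn hs (hmin x hx) (hmin y hy) (hdom hx) (hdom hy)

theorem IsGammaZero.mul_norm_sub_le_of_sphere (hf : IsGammaZero f) {z x : E} {μ a c r : ℝ}
    (hr : 0 < r) (hz : f z ≤ μ) (ha : ∀ y ∈ Metric.sphere z r, (a : EReal) ≤ f y) (hx : f x ≤ c)
    (hrx : r ≤ ‖x - z‖) : (a - μ) * ‖x - z‖ ≤ r * (c - μ) := by
  have hpos : 0 < ‖x - z‖ := hr.trans_le hrx
  set t := r / ‖x - z‖
  have ht₀ : 0 ≤ t := by positivity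
  have ht₁ : 0 ≤ 1 - t := sub_nonneg.2 ((div_le_one hpos).2 hrx)
  have htr : t * ‖x - z‖ = r := div_mul_cancel₀ r hpos.ne'
  have hmem : (1 - t) • z + t • x ∈ Metric.sphere z r := by
    have : (1 - t) • z + t • x - z = t • (x - z) := by module
    rw [mem_sphere_iff_norm, this, norm_smul, Real.norm_of_nonneg ht₀, htr]
  have hchord : a ≤ (1 - t) * μ + t * c := EReal.coe_le_coe_iff.1
    ((ha _ hmem).trans (hf.le_segment hz hx ht₁ ht₀ (sub_add_cancel 1 t)))
  calc (a - μ) * ‖x - z‖ ≤ t * (c - μ) * ‖x - z‖ := by gcongr; linarith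
    _ = r * (c - μ) := by rw [← htr]; ring

variable [FiniteDimensional ℝ E]

theorem IsGammaZero.isBounded_sublevel (hf : IsGammaZero f) {z : E} (hz : f z ≠ ⊤)
    (hb : Bornology.IsBounded {x | f x ≤ f z}) (c : ℝ) : Bornology.IsBounded {x | f x ≤ c} := by
  obtain ⟨μ, hμ⟩ : ∃ μ : ℝ, f z = μ := ⟨_, (EReal.coe_toReal hz (hf.ne_bot z)).symm⟩
  obtain ⟨r, hr, hball⟩ := hb.subset_ball_lt 0 z
  have hsphere : ∀ y ∈ Metric.sphere z r, (μ : EReal) < f y := fun y hy => by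
    by_contra! h
    exact (Metric.mem_ball.1 (hball (hμ ▸ h))).ne hy
  obtain ⟨a, hμa, ha⟩ := exists_coe_lt_forall_le_of_isCompact (isCompact_sphere z r)
    (hf.lsc.lowerSemicontinuousOn _) hsphere
  refine Metric.isBounded_closedBall (x := z) (r := max r (r * (c - μ) / (a - μ))) |>.subset
    fun x hx => ?_
  rw [mem_closedBall_iff_norm, le_max_iff, le_div_iff₀' (sub_pos.2 hμa)]
  exact (le_total ‖x - z‖ r).imp_right (hf.mul_norm_sub_le_of_sphere hr hμ.le ha hx)

/-- The set in `hb` is the set of minimizers of the closed convex function `f + p (· - z)`, all of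
whose sublevel sets are therefore bounded. -/
theorem IsGammaZero.isBounded_sublevel_inter (hf : IsGammaZero f) {p : Seminorm ℝ E} {z : E}
    (hz : z ∈ argmin f) (hb : Bornology.IsBounded {x ∈ argmin f | p (x - z) = 0}) (c t : ℝ) :
    Bornology.IsBounded {x | f x ≤ c ∧ p x ≤ t} := by
  obtain ⟨μ, hμ, hle⟩ := hf.exists_eq_coe_and_forall_le hz
  have hg : IsGammaZero fun x => f x + (p (x - z) : EReal) := hf.add_coe
    (by simpa [Function.comp_def, sub_eq_add_neg] using p.convexOn.translate_left (-z))
    ((continuous_seminorm p).comp (continuous_sub_right z)).lowerSemicontinuous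
  have hgz : f z + (p (z - z) : EReal) = μ := by simp [hμ]
  have hsub : {x | f x + (p (x - z) : EReal) ≤ f z + (p (z - z) : EReal)} ⊆
      {x ∈ argmin f | p (x - z) = 0} := fun x hx => by
    have hx' : f x + (p (x - z) : EReal) ≤ μ := hgz ▸ hx
    have hfx : f x ≤ μ := le_of_add_le_of_nonneg_left hx' (EReal.coe_nonneg.2 (apply_nonneg p _))
    have hpx : μ ≤ μ - p (x - z) :=
      EReal.coe_le_coe_iff.1 ((hle x).trans (add_coe_le_coe_iff.1 hx'))
    exact ⟨⟨trivial, fun y _ => hfx.trans (hle y)⟩,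
      le_antisymm (by linarith) (apply_nonneg p _)⟩
  refine (hg.isBounded_sublevel (hgz ▸ EReal.coe_ne_top μ) (hb.subset hsub) (c + (t + p z))).subset
    fun x hx => ?_
  have hpx : p (x - z) ≤ t + p z := (map_sub_le_add p x z).trans (by gcongr; exact hx.2)
  simpa using add_le_add hx.1 (EReal.coe_le_coe_iff.2 hpx)

theorem isBounded_setOf_seminorm_le {N : Seminorm ℝ E} (hN : ∀ y, N y = 0 → y = 0) (t : ℝ) :
    Bornology.IsBounded {x | N x ≤ t} := by
  have h := isGammaZero_zero.isBounded_sublevel_inter (p := N) (z := 0)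
    ⟨trivial, fun _ _ => le_rfl⟩
    (Bornology.isBounded_singleton (x := (0 : E)) |>.subset fun x hx => by
      simpa using hN _ hx.2) 0 t
  simpa using h

end GammaZero

section Existence

variable {E : Type*} [NormedAddCommGroup E] [InnerProductSpace ℝ E] [FiniteDimensional ℝ E]
  {f : E → EReal}

theorem hasSolutionWithFiniteMin_of_isBounded {S : Set E} (hf : LowerSemicontinuous f)
    (hS : IsClosed S) (hbot : ∀ x ∈ S, f x ≠ ⊥) {x₀ : E} (hx₀ : x₀ ∈ S) (htop : f x₀ ≠ ⊤)
    (hb : Bornology.IsBounded {x ∈ S | f x ≤ f x₀}) : HasSolutionWithFiniteMin f S := by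
  have hK : IsCompact {x ∈ S | f x ≤ f x₀} :=
    Metric.isCompact_of_isClosed_isBounded (hS.inter (hf.isClosed_preimage (f x₀))) hb
  have hne : {x ∈ S | f x ≤ f x₀}.Nonempty := ⟨x₀, hx₀, le_rfl⟩
  obtain ⟨z, ⟨hzS, hzx₀⟩, hz⟩ := (hf.lowerSemicontinuousOn _).exists_isMinOn hne hK
  have hmin : ∀ y ∈ S, f z ≤ f y := fun y hy =>
    (le_total (f y) (f x₀)).elim (fun h => hz ⟨hy, h⟩) hzx₀.trans
  have hfz : ((f z).toReal : EReal) = f z :=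
    EReal.coe_toReal (ne_top_of_le_ne_top htop hzx₀) (hbot z hzS)
  exact ⟨⟨z, hzS, hmin⟩, (f z).toReal, ⟨z, hzS, hfz.symm⟩,
    by rintro _ ⟨y, hy, rfl⟩; exact hfz.trans_le (hmin y hy)⟩

section Primal

variable {p : Seminorm ℝ E} {z : E}

theorem IsGammaZero.hasSolutionWithFiniteMin_seminorm_le (hf : IsGammaZero f) (hz : z ∈ argmin f)
    (hb : Bornology.IsBounded {x ∈ argmin f | p (x - z) = 0}) {x₀ : E} (hx₀ : f x₀ ≠ ⊤) {τ : ℝ}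
    (hτ : p x₀ ≤ τ) : HasSolutionWithFiniteMin f {x | p x ≤ τ} := by
  refine hasSolutionWithFiniteMin_of_isBounded hf.lsc
    (isClosed_le (continuous_seminorm p) continuous_const) (fun x _ => hf.ne_bot x) hτ hx₀
    ((hf.isBounded_sublevel_inter hz hb (f x₀).toReal τ).subset fun x hx => ?_)
  exact ⟨hx.2.trans (EReal.le_coe_toReal hx₀), hx.1⟩

theorem IsGammaZero.hasSolutionWithFiniteMin_add_seminorm (hf : IsGammaZero f)
    (hz : z ∈ argmin f) (hb : Bornology.IsBounded {x ∈ argmin f | p (x - z) = 0}) {l : ℝ}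
    (hl : 0 < l) :
    HasSolutionWithFiniteMin (fun x => f x + ((l * p x : ℝ) : EReal)) Set.univ := by
  obtain ⟨μ, hμ, hle⟩ := hf.exists_eq_coe_and_forall_le hz
  have hval : f z + ((l * p z : ℝ) : EReal) = ((μ + l * p z : ℝ) : EReal) := by
    rw [hμ, EReal.coe_add]
  have hlsc : LowerSemicontinuous fun x => l * p x :=
    (continuous_const.mul (continuous_seminorm p)).lowerSemicontinuous
  refine hasSolutionWithFiniteMin_of_isBounded (lowerSemicontinuous_add_coe hf.lsc hlsc)
    isClosed_univ (fun x _ => EReal.add_ne_bot_iff.2 ⟨hf.ne_bot x, EReal.coe_ne_bot _⟩)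
    (Set.mem_univ z) (hval ▸ EReal.coe_ne_top _)
    ((hf.isBounded_sublevel_inter hz hb (μ + l * p z) (p z)).subset fun x ⟨_, hx⟩ => ?_)
  rw [hval] at hx
  have hpen : μ ≤ μ + l * p z - l * p x :=
    EReal.coe_le_coe_iff.1 ((hle x).trans (add_coe_le_coe_iff.1 hx))
  exact ⟨le_of_add_le_of_nonneg_left hx (EReal.coe_nonneg.2 (by positivity)),
    le_of_mul_le_mul_left (by linarith) hl⟩

end Primal

end Existence

section DualNorm

variable {F : Type*} [NormedAddCommGroup F] [InnerProductSpace ℝ F] [FiniteDimensional ℝ F]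
  {N : Seminorm ℝ F}

theorem bddAbove_dualNorm (hN : ∀ y, N y = 0 → y = 0) (p : F) :
    BddAbove {r : ℝ | ∃ x : F, N x ≤ 1 ∧ r = inner ℝ p x} := by
  obtain ⟨R, hR⟩ := (isBounded_setOf_seminorm_le hN 1).exists_norm_le
  refine ⟨‖p‖ * R, ?_⟩
  rintro _ ⟨x, hx, rfl⟩
  exact (real_inner_le_norm p x).trans (by gcongr; exact hR x hx)

theorem dualNorm_le_iff (hN : ∀ y, N y = 0 → y = 0) {p : F} {l : ℝ} :
    dualNorm N p ≤ l ↔ ∀ x, N x ≤ 1 → inner ℝ p x ≤ l := by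
  rw [dualNorm, csSup_le_iff (bddAbove_dualNorm hN p) ⟨0, 0, by simp⟩]
  exact ⟨fun h x hx => h _ ⟨x, hx, rfl⟩, by rintro h _ ⟨x, hx, rfl⟩; exact h x hx⟩

theorem isClosed_setOf_dualNorm_le (hN : ∀ y, N y = 0 → y = 0) (l : ℝ) :
    IsClosed {p : F | dualNorm N p ≤ l} := by
  simp only [dualNorm_le_iff hN, Set.ofPred_forall]
  exact isClosed_iInter fun x => isClosed_iInter fun _ =>
    isClosed_le (by fun_prop) continuous_const

theorem lowerSemicontinuous_dualNorm (hN : ∀ y, N y = 0 → y = 0) :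
    LowerSemicontinuous (dualNorm N) :=
  lowerSemicontinuous_iff_isClosed_preimage.2 (isClosed_setOf_dualNorm_le hN)

theorem dualNorm_nonneg (hN : ∀ y, N y = 0 → y = 0) (p : F) : 0 ≤ dualNorm N p :=
  le_csSup (bddAbove_dualNorm hN p) ⟨0, by simp⟩

theorem dualNorm_zero (hN : ∀ y, N y = 0 → y = 0) : dualNorm N 0 = 0 :=
  le_antisymm ((dualNorm_le_iff hN).2 (by simp)) (dualNorm_nonneg hN 0)

theorem inner_le_dualNorm_mul (hN : ∀ y, N y = 0 → y = 0) (p x : F) :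
    inner ℝ p x ≤ dualNorm N p * N x := by
  rcases (apply_nonneg N x).eq_or_lt with hx | hx
  · simp [hN x hx.symm]
  · have hunit : N ((N x)⁻¹ • x) ≤ 1 := by
      rw [map_smul_eq_mul, norm_inv, Real.norm_of_nonneg hx.le, inv_mul_cancel₀ hx.ne']
    have h := (dualNorm_le_iff hN (p := p)).1 le_rfl _ hunit
    rwa [inner_smul_right, inv_mul_le_iff₀' hx] at h

theorem isBounded_setOf_dualNorm_le (hN : ∀ y, N y = 0 → y = 0) (l : ℝ) :
    Bornology.IsBounded {p : F | dualNorm N p ≤ l} := by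
  obtain ⟨C, hC, hNC⟩ := Seminorm.bound_of_continuous_normedSpace N (continuous_seminorm N)
  refine isBounded_iff_forall_norm_le.2 ⟨l * C, fun p hp => ?_⟩
  have hl : 0 ≤ l := (dualNorm_nonneg hN p).trans hp
  have h : ‖p‖ * ‖p‖ ≤ l * C * ‖p‖ := calc
    ‖p‖ * ‖p‖ = inner ℝ p p := (real_inner_self_eq_norm_mul_norm p).symm
    _ ≤ dualNorm N p * N p := inner_le_dualNorm_mul hN p p
    _ ≤ l * (C * ‖p‖) := by gcongr; exacts [hp, hNC p]
    _ = l * C * ‖p‖ := (mul_assoc _ _ _).symm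
  rcases (norm_nonneg p).eq_or_lt with hp₀ | hp₀
  · exact hp₀ ▸ by positivity
  · exact le_of_mul_le_mul_right h hp₀

end DualNorm

section Dual

variable {E : Type*} [NormedAddCommGroup E] [InnerProductSpace ℝ E] {f : E → EReal} {μ : ℝ}

theorem lowerSemicontinuous_conjugate (f : E → EReal) : LowerSemicontinuous (conjugate f) := by
  refine lowerSemicontinuous_iSup fun x => ?_
  have hc : Continuous fun p : E => ((inner ℝ p x : ℝ) : EReal) :=
    continuous_coe_real_ereal.comp (by fun_prop)
  simp only [sub_eq_add_neg]
  exact hc.lowerSemicontinuous.add' lowerSemicontinuous_const fun p =>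
    EReal.continuousAt_add (Or.inl (EReal.coe_ne_top _)) (Or.inl (EReal.coe_ne_bot _))

theorem coe_inner_sub_le_conjugate {x : E} {c : ℝ} (hx : f x ≤ c) (p : E) :
    ((inner ℝ p x - c : ℝ) : EReal) ≤ conjugate f p :=
  (EReal.sub_le_sub le_rfl hx).trans
    (le_iSup (fun x : E => ((inner ℝ p x : ℝ) : EReal) - f x) x)

theorem conjugate_ne_bot {x : E} (hx : f x ≠ ⊤) (p : E) : conjugate f p ≠ ⊥ :=
  ne_bot_of_le_ne_bot (EReal.coe_ne_bot _)
    (coe_inner_sub_le_conjugate (EReal.le_coe_toReal hx) p)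

theorem conjugate_zero_le (hμ : ∀ x, (μ : EReal) ≤ f x) :
    conjugate f 0 ≤ ((-μ : ℝ) : EReal) :=
  iSup_le fun x => by simpa using hμ x

variable {F : Type*} [NormedAddCommGroup F] [InnerProductSpace ℝ F] [FiniteDimensional ℝ F]
  {N : Seminorm ℝ F}

theorem lowerSemicontinuous_conjugate_comp_neg (f : E → EReal) (B : F →ₗ[ℝ] E) :
    LowerSemicontinuous fun p => conjugate f (-(B p)) :=
  (lowerSemicontinuous_conjugate f).comp B.continuous_of_finiteDimensional.neg

theorem hasSolutionWithFiniteMin_conjugate_dualNorm_le (hμ : ∀ x, (μ : EReal) ≤ f x) {x₀ : E}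
    (hx₀ : f x₀ ≠ ⊤) (hN : ∀ y, N y = 0 → y = 0) (B : F →ₗ[ℝ] E) {l : ℝ} (hl : 0 ≤ l) :
    HasSolutionWithFiniteMin (fun p => conjugate f (-(B p))) {p | dualNorm N p ≤ l} := by
  refine hasSolutionWithFiniteMin_of_isBounded (lowerSemicontinuous_conjugate_comp_neg f B)
    (isClosed_setOf_dualNorm_le hN l) (fun p _ => conjugate_ne_bot hx₀ _) (x₀ := 0)
    ((dualNorm_zero hN).trans_le hl) ?_ ((isBounded_setOf_dualNorm_le hN l).subset fun p hp => hp.1)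
  simpa using ne_top_of_le_ne_top (EReal.coe_ne_top _) (conjugate_zero_le hμ)

/-- Testing the conjugate at `x₀` bounds the objective from below by
`(τ - N (A x₀)) * dualNorm N p - f x₀`, hence its sublevel sets are bounded. -/
theorem hasSolutionWithFiniteMin_conjugate_add_dualNorm (hμ : ∀ x, (μ : EReal) ≤ f x)
    (hN : ∀ y, N y = 0 → y = 0) {A : E →ₗ[ℝ] F} {B : F →ₗ[ℝ] E}
    (hBA : ∀ p x, inner ℝ (B p) x = inner ℝ p (A x)) {x₀ : E} (hx₀ : f x₀ ≠ ⊤) {τ : ℝ}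
    (hτ : N (A x₀) < τ) :
    HasSolutionWithFiniteMin
      (fun p => conjugate f (-(B p)) + ((τ * dualNorm N p : ℝ) : EReal)) Set.univ := by
  have hτ₀ : 0 < τ := (apply_nonneg N _).trans_lt hτ
  have hzero : conjugate f (-(B 0)) + ((τ * dualNorm N 0 : ℝ) : EReal) ≤ ((-μ : ℝ) : EReal) := by
    simpa [dualNorm_zero hN] using conjugate_zero_le hμ
  have hlsc : LowerSemicontinuous fun p => τ * dualNorm N p :=
    (continuous_const_mul τ).comp_lowerSemicontinuous (lowerSemicontinuous_dualNorm hN)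
      (monotone_mul_left_of_nonneg hτ₀.le)
  set c := (f x₀).toReal
  refine hasSolutionWithFiniteMin_of_isBounded
    (lowerSemicontinuous_add_coe (lowerSemicontinuous_conjugate_comp_neg f B) hlsc) isClosed_univ
    (fun p _ => EReal.add_ne_bot_iff.2 ⟨conjugate_ne_bot hx₀ _, EReal.coe_ne_bot _⟩)
    (Set.mem_univ 0)
    (ne_top_of_le_ne_top (EReal.coe_ne_top _) hzero)
    ((isBounded_setOf_dualNorm_le hN ((c - μ) / (τ - N (A x₀)))).subset fun p ⟨_, hp⟩ => ?_)
  have hobj : -inner ℝ p (A x₀) - c ≤ -μ - τ * dualNorm N p := by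
    rw [← hBA, ← inner_neg_left]
    exact EReal.coe_le_coe_iff.1 ((coe_inner_sub_le_conjugate (EReal.le_coe_toReal hx₀) _).trans
      (add_coe_le_coe_iff.1 (hp.trans hzero)))
  have hinner : inner ℝ p (A x₀) ≤ dualNorm N p * N (A x₀) := inner_le_dualNorm_mul hN p (A x₀)
  exact (le_div_iff₀ (sub_pos.2 hτ)).2 (by linarith)

end Dual

section Setting

variable {E : Type*} [NormedAddCommGroup E] [InnerProductSpace ℝ E] {Φ : E → EReal}
  {X₁ X₂ X₃ : Submodule ℝ E}

theorem exists_mem_effDom_seminorm_lt [FiniteDimensional ℝ E] (h : (0 : E) ∈ closure (effDom Φ))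
    (p : Seminorm ℝ E) {τ : ℝ} (hτ : 0 < τ) : ∃ x ∈ effDom Φ, p x < τ := by
  have hopen : IsOpen {x | p x < τ} := isOpen_lt (continuous_seminorm p) continuous_const
  obtain ⟨x, hxτ, hx⟩ := mem_closure_iff.1 h _ hopen (by simpa using hτ)
  exact ⟨x, hx, hxτ⟩

theorem IsSetting.zero_mem_closure_effDom (h : IsSetting Φ X₁ X₂ X₃) :
    (0 : E) ∈ closure (effDom Φ) :=
  map_mem_closure (f := ((↑) : X₁ → E)) continuous_subtype_val h.zero_mem fun _ hx => hx

theorem IsSetting.exists_eq_add_of_mem_effDom (h : IsSetting Φ X₁ X₂ X₃) {x : E}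
    (hx : x ∈ effDom Φ) : ∃ x₁ : X₁, ∃ x₂ ∈ X₂, x = x₁ + x₂ ∧ Φ x = Φ x₁ := by
  obtain ⟨y, hy, x₃, h₃, rfl⟩ := Submodule.mem_sup.1 (h.span ▸ Submodule.mem_top : x ∈ X₁ ⊔ X₂ ⊔ X₃)
  obtain ⟨x₁, h₁, x₂, h₂, rfl⟩ := Submodule.mem_sup.1 hy
  have hx₃ : x₃ = 0 := by
    by_contra hne
    exact hx.ne (h.eq_of_ne_zero x₁ h₁ x₂ h₂ x₃ h₃ hne)
  exact ⟨⟨x₁, h₁⟩, x₂, h₂, by simp [hx₃], h.eq_of_eq_zero x₁ h₁ x₂ h₂ x₃ h₃ hx₃⟩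

theorem IsSetting.coe_mem_argmin (h : IsSetting Φ X₁ X₂ X₃) {z : X₁}
    (hz : z ∈ argmin fun x : X₁ => Φ x) : (z : E) ∈ argmin Φ := by
  refine ⟨trivial, fun y _ => ?_⟩
  by_cases hy : y ∈ effDom Φ
  · obtain ⟨y₁, -, -, -, hΦy⟩ := h.exists_eq_add_of_mem_effDom hy
    exact hΦy ▸ hz.2 y₁ trivial
  · exact le_top.trans (not_lt_top_iff.1 hy).ge

theorem IsSetting.sub_mem_of_mem_argmin (h : IsSetting Φ X₁ X₂ X₃) {z : X₁}
    (hz : z ∈ argmin fun x : X₁ => Φ x) {x : E} (hx : x ∈ argmin Φ) : x - z ∈ X₂ := by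
  obtain ⟨y, hy⟩ := h.gammaZero.dom_nonempty
  obtain ⟨x₁, x₂, hx₂, rfl, hΦx⟩ :=
    h.exists_eq_add_of_mem_effDom ((hx.2 y trivial).trans_lt hy)
  have hx₁ : x₁ ∈ argmin fun x : X₁ => Φ x :=
    ⟨trivial, fun y _ => hΦx.ge.trans (hx.2 y trivial)⟩
  obtain rfl : x₁ = z := h.gammaZero.argmin_subsingleton h.strictlyConvex hx₁ hz
  simpa using hx₂

theorem IsSetting.exists_argmin_inter_fiber_eq_singleton {F : Type*} [AddCommGroup F] [Module ℝ F]
    (h : IsSetting Φ X₁ X₂ X₃) {A : E →ₗ[ℝ] F} (hA : X₂ ⊓ LinearMap.ker A = ⊥) :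
    ∃ z ∈ argmin Φ, {x ∈ argmin Φ | A x = A z} = {z} := by
  obtain ⟨z, hz⟩ := h.exists_minimizer
  refine ⟨z, h.coe_mem_argmin hz, Set.eq_singleton_iff_unique_mem.2
    ⟨⟨h.coe_mem_argmin hz, rfl⟩, fun x ⟨hx, hAx⟩ => sub_eq_zero.1 ?_⟩⟩
  rw [← Submodule.mem_bot ℝ, ← hA]
  exact ⟨h.sub_mem_of_mem_argmin hz hx, LinearMap.sub_mem_ker_iff.2 hAx⟩

end Setting

theorem toEuclideanLin_transpose {m n : Type*} [Fintype m] [DecidableEq m] [Fintype n]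
    [DecidableEq n] (L : Matrix m n ℝ) :
    Matrix.toEuclideanLin L.transpose = LinearMap.adjoint (Matrix.toEuclideanLin L) := by
  rw [← Matrix.conjTranspose_eq_transpose_of_trivial,
    Matrix.toEuclideanLin_conjTranspose_eq_adjoint]

end Solvers

theorem mainTheorem10_general {E F : Type*} [NormedAddCommGroup E] [InnerProductSpace ℝ E]
    [FiniteDimensional ℝ E] [NormedAddCommGroup F] [InnerProductSpace ℝ F] [FiniteDimensional ℝ F]
    {Φ : E → EReal} (hΦ : Solvers.IsGammaZero Φ) (hdom : 0 ∈ closure (Solvers.effDom Φ))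
    (A : E →ₗ[ℝ] F) {z : E} (hz : z ∈ Solvers.argmin Φ)
    (hfiber : Bornology.IsBounded {x ∈ Solvers.argmin Φ | A x = A z})
    {N : Seminorm ℝ F} (hN : ∀ y, N y = 0 → y = 0) :
    (∀ τ : ℝ, 0 < τ →
      Solvers.HasSolutionWithFiniteMin Φ {x | N (A x) ≤ τ} ∧
      Solvers.HasSolutionWithFiniteMin
        (fun p => Solvers.conjugate Φ (-(LinearMap.adjoint A p)) +
          ((τ * Solvers.dualNorm N p : ℝ) : EReal)) Set.univ) ∧
    (∀ l : ℝ, 0 < l →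
      Solvers.HasSolutionWithFiniteMin
        (fun x => Φ x + ((l * N (A x) : ℝ) : EReal)) Set.univ ∧
      Solvers.HasSolutionWithFiniteMin
        (fun p => Solvers.conjugate Φ (-(LinearMap.adjoint A p)))
        {p | Solvers.dualNorm N p ≤ l}) := by
  have hb : Bornology.IsBounded {x ∈ Solvers.argmin Φ | N.comp A (x - z) = 0} :=
    hfiber.subset fun x ⟨hx, hNx⟩ => ⟨hx, sub_eq_zero.1 ((map_sub A x z).symm.trans (hN _ hNx))⟩
  obtain ⟨μ, -, hμ⟩ := hΦ.exists_eq_coe_and_forall_le hz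
  obtain ⟨y, hy⟩ := hΦ.dom_nonempty
  refine ⟨fun τ hτ => ?_, fun l hl => ?_⟩
  · obtain ⟨x₀, hx₀, hx₀τ⟩ := Solvers.exists_mem_effDom_seminorm_lt hdom (N.comp A) hτ
    exact ⟨hΦ.hasSolutionWithFiniteMin_seminorm_le (p := N.comp A) hz hb (ne_of_lt hx₀) hx₀τ.le,
      Solvers.hasSolutionWithFiniteMin_conjugate_add_dualNorm hμ hN
        (fun p x => A.adjoint_inner_left x p) (ne_of_lt hx₀) hx₀τ⟩
  · exact ⟨hΦ.hasSolutionWithFiniteMin_add_seminorm (p := N.comp A) hz hb hl,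
      Solvers.hasSolutionWithFiniteMin_conjugate_dualNorm_le hμ (ne_of_lt hy) hN _ hl.le⟩

theorem mainTheorem10 {n m : ℕ}
    (Φ : EuclideanSpace ℝ (Fin n) → EReal)
    (X₁ X₂ X₃ : Submodule ℝ (EuclideanSpace ℝ (Fin n)))
    (L : Matrix (Fin m) (Fin n) ℝ)
    (N : Seminorm ℝ (EuclideanSpace ℝ (Fin m)))
    (hN : ∀ y, N y = 0 → y = 0)
    (hΦ : Solvers.IsGammaZero Φ)
    (hset : Solvers.IsSetting Φ X₁ X₂ X₃)
    (hX₂ : X₂ ⊓ LinearMap.ker (Matrix.toEuclideanLin L) = ⊥)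
    (hargmin : Solvers.argmin Φ ∩
      (LinearMap.ker (Matrix.toEuclideanLin L) : Set (EuclideanSpace ℝ (Fin n))) = ∅) :
    (∀ τ : ℝ, 0 < τ →
      Solvers.HasSolutionWithFiniteMin Φ {x | N (Matrix.toEuclideanLin L x) ≤ τ} ∧
      Solvers.HasSolutionWithFiniteMin
        (fun p => Solvers.conjugate Φ (-(Matrix.toEuclideanLin L.transpose p)) +
          ((τ * Solvers.dualNorm N p : ℝ) : EReal)) Set.univ) ∧
    (∀ l : ℝ, 0 < l →
      Solvers.HasSolutionWithFiniteMin
        (fun x => Φ x + ((l * N (Matrix.toEuclideanLin L x) : ℝ) : EReal)) Set.univ ∧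
      Solvers.HasSolutionWithFiniteMin
        (fun p => Solvers.conjugate Φ (-(Matrix.toEuclideanLin L.transpose p)))
        {p | Solvers.dualNorm N p ≤ l}) := by
  obtain ⟨z, hz, hfiber⟩ := hset.exists_argmin_inter_fiber_eq_singleton hX₂
  simpa only [Solvers.toEuclideanLin_transpose] using mainTheorem10_general hΦ
    hset.zero_mem_closure_effDom _ hz (hfiber ▸ Bornology.isBounded_singleton) hN
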